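/- Let $t\in\{3,4\}$ and let $n\ge t$ be an integer. An orthogonal array $OA(t,n)$ is a $t\times n^2$ matrix with entries from $\{1,\dots,n\}$ such that, for any two distinct rows, the $n^2$ ordered pairs they define are all distinct. Its associated graph has the $n^2$ columns as vertices, two distinct columns being adjacent if they have the same entry in some coordinate position. Then for every orthogonal array $OA(t,n)$ the associated graph $G$ is a connected strongly regular graph with parameters $$(v,k,\lambda,\mu)=\bigl(n^2,\;t(n-1),\;n-2+(t-1)(t-2),\;t(t-1)\bigr),$$ and it satisfies Brouwer's conjecture: either there is no set $S$ of vertices such that $G\setminus S$ is disconnected and each of its components has at least two vertices, or the minimum size of such a set $S$ is exactly $2k-\lambda-2$. -/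

import Mathlib

/-- `A` is an orthogonal array `OA(t,n)`: a `t × n²` matrix with entries from an `n`-element set such
that, for any two distinct rows, the `n²` ordered pairs formed by them are all distinct. -/
def IsOrthogonalArray (t n : ℕ) (A : Matrix (Fin t) (Fin (n ^ 2)) (Fin n)) : Prop :=
  ∀ i j : Fin t, i ≠ j → Function.Injective fun c : Fin (n ^ 2) => (A i c, A j c)

/-- The graph of an array: vertices are the columns, two distinct columns being adjacent if they have
the same entry in some coordinate position. -/
def orthogonalArrayGraph {t n : ℕ} (A : Matrix (Fin t) (Fin (n ^ 2)) (Fin n)) :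
    SimpleGraph (Fin (n ^ 2)) where
  Adj c d := c ≠ d ∧ ∃ i : Fin t, A i c = A i d
  symm := ⟨fun _ _ h => ⟨h.1.symm, h.2.imp fun _ hi => hi.symm⟩⟩
  loopless := ⟨fun _ h => h.1 rfl⟩

instance orthogonalArrayGraph.decidableRelAdj {t n : ℕ} (A : Matrix (Fin t) (Fin (n ^ 2)) (Fin n)) :
    DecidableRel (orthogonalArrayGraph A).Adj := fun c d =>
  inferInstanceAs (Decidable (c ≠ d ∧ ∃ i : Fin t, A i c = A i d))

/-- Removing the vertex set `S` disconnects `G` (at least two components remain), and every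
component that remains has at least two vertices. -/
def DisconnectsIntoNonSingletons {V : Type*} (G : SimpleGraph V) (S : Finset V) : Prop :=
  ¬ (G.induce {x : V | x ∉ S}).Preconnected ∧
    ∀ c : (G.induce {x : V | x ∉ S}).ConnectedComponent, 2 ≤ c.supp.ncard

/-- `G` is a connected `(v,k,l,m)`-strongly regular graph for which Brouwer's conjecture holds:
either no vertex set disconnects it into non-singleton components, or the minimum size of such a set
is `2k - l - 2`. -/
structure SatisfiesBrouwerConjecture {V : Type*} [Fintype V] (G : SimpleGraph V)
    [DecidableRel G.Adj] (v k l m : ℕ) : Prop where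
  isSRG : G.IsSRGWith v k l m
  connected : G.Connected
  ok : (¬ ∃ S : Finset V, DisconnectsIntoNonSingletons G S) ∨
    IsLeast {s : ℤ | ∃ S : Finset V, DisconnectsIntoNonSingletons G S ∧ (S.card : ℤ) = s}
      (2 * (k : ℤ) - (l : ℤ) - 2)

/-! The number `2k - λ - 2` equals `(2t-1)n - t(t-1) - 2`, the number of vertices outside an edge
that are adjacent to one of its ends. A disconnecting set of the required kind is the complement of
a split `(X, Y)`, so two things are needed: an upper bound on `#X + #Y`, and a split that attains
it.

The bound is a second moment argument. Choose a set of entries `R i` in each coordinate and let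
`hits` count, for a column, the coordinates whose entry is chosen. The array property makes the
first two moments of `hits` depend only on the sizes of the `R i`. If `R i` consists of the entries
of `X`, then `hits` is `t` on `X` and `0` on `Y`. Since `(m - a)(m - a - 1) ≥ 0` for integers,
summing over all columns bounds a weighted sum of `#X` and `#Y` (`card_add_card_le`) in terms of
`e`, the total number of entries of `X`. Estimates on `e` and rounding give the exact bound for `t =
3, 4`.

For attainment, take an edge `uv` and the columns far from it. If no far column is isolated among
the far columns, this is a split of the right size. A line count shows this for `n ≥ 2t - 1`, and a
parity argument for `(t, n) = (4, 6)`. In the remaining small cases the upper bound either excludes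
all splits or forces every split to attain it. -/

/-- `X` and `Y` are nonempty disjoint vertex sets with no edge between them, and neither of them
induces an isolated vertex. -/
structure IsSplit {V : Type*} (G : SimpleGraph V) (X Y : Finset V) : Prop where
  disjoint : Disjoint X Y
  nonempty_left : X.Nonempty
  nonempty_right : Y.Nonempty
  not_adj : ∀ x ∈ X, ∀ y ∈ Y, ¬ G.Adj x y
  exists_adj_left : ∀ x ∈ X, ∃ y ∈ X, G.Adj x y
  exists_adj_right : ∀ x ∈ Y, ∃ y ∈ Y, G.Adj x y

lemma IsSplit.symm {V : Type*} {G : SimpleGraph V} {X Y : Finset V} (h : IsSplit G X Y) :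
    IsSplit G Y X :=
  ⟨h.disjoint.symm, h.nonempty_right, h.nonempty_left,
    fun x hx y hy hxy => h.not_adj y hy x hx hxy.symm, h.exists_adj_right, h.exists_adj_left⟩

lemma exists_adj_of_two_le_ncard_supp {V : Type*} {H : SimpleGraph V} (v : V)
    (h : 2 ≤ (H.connectedComponentMk v).supp.ncard) : ∃ w, H.Adj v w := by
  obtain ⟨w, hw, hne⟩ := Set.exists_ne_of_one_lt_ncard h v
  have hr : H.Reachable v w := (SimpleGraph.ConnectedComponent.exact hw).symm
  obtain ⟨p⟩ := hr
  cases p with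
  | nil => exact absurd rfl hne
  | cons hadj _ => exact ⟨_, hadj⟩

/-- `X` is one component of what remains and `Y` the union of the others. -/
lemma DisconnectsIntoNonSingletons.exists_isSplit {V : Type*} [Fintype V] [DecidableEq V]
    {G : SimpleGraph V} {S : Finset V} (h : DisconnectsIntoNonSingletons G S) :
    ∃ X Y : Finset V, IsSplit G X Y ∧ X ∪ Y = Sᶜ := by
  classical
  obtain ⟨hpre, hcomp⟩ := h
  simp only [SimpleGraph.Preconnected, not_forall] at hpre
  obtain ⟨x, y, hxy⟩ := hpre
  set H := G.induce {x : V | x ∉ S} with hH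
  have hnb : ∀ v : {x : V | x ∉ S}, ∃ w, H.Adj v w := fun v =>
    exists_adj_of_two_le_ncard_supp v (hcomp _)
  refine ⟨Finset.univ.filter fun v => ∃ hv : v ∉ S, H.Reachable x ⟨v, hv⟩,
    Finset.univ.filter fun v => ∃ hv : v ∉ S, ¬ H.Reachable x ⟨v, hv⟩, ⟨?_, ?_, ?_, ?_, ?_, ?_⟩, ?_⟩
  · rw [Finset.disjoint_left]
    intro v hv hv'
    simp only [Finset.mem_filter, Finset.mem_univ, true_and] at hv hv'
    obtain ⟨_, h1⟩ := hv
    obtain ⟨_, h2⟩ := hv'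
    exact h2 h1
  · exact ⟨x, Finset.mem_filter.2 ⟨Finset.mem_univ _, x.2, SimpleGraph.Reachable.refl _⟩⟩
  · exact ⟨y, Finset.mem_filter.2 ⟨Finset.mem_univ _, y.2, hxy⟩⟩
  · intro v hv w hw hvw
    simp only [Finset.mem_filter, Finset.mem_univ, true_and] at hv hw
    obtain ⟨hv, h1⟩ := hv
    obtain ⟨hw, h2⟩ := hw
    have : H.Adj ⟨v, hv⟩ ⟨w, hw⟩ := hvw
    exact h2 (h1.trans this.reachable)
  · intro v hv
    simp only [Finset.mem_filter, Finset.mem_univ, true_and] at hv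
    obtain ⟨hv, h1⟩ := hv
    obtain ⟨w, hw⟩ := hnb ⟨v, hv⟩
    exact ⟨w, Finset.mem_filter.2 ⟨Finset.mem_univ _, w.2, h1.trans hw.reachable⟩, hw⟩
  · intro v hv
    simp only [Finset.mem_filter, Finset.mem_univ, true_and] at hv
    obtain ⟨hv, h1⟩ := hv
    obtain ⟨w, hw⟩ := hnb ⟨v, hv⟩
    exact ⟨w, Finset.mem_filter.2 ⟨Finset.mem_univ _, w.2,
      fun h2 => h1 (h2.trans hw.symm.reachable)⟩, hw⟩
  · ext v
    simp only [Finset.mem_union, Finset.mem_filter, Finset.mem_univ, true_and, Finset.mem_compl]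
    constructor
    · rintro (⟨hv, _⟩ | ⟨hv, _⟩) <;> exact hv
    · intro hv
      by_cases hr : H.Reachable x ⟨v, hv⟩
      · exact Or.inl ⟨hv, hr⟩
      · exact Or.inr ⟨hv, hr⟩

lemma IsSplit.disconnectsIntoNonSingletons {V : Type*} [Fintype V] [DecidableEq V]
    {G : SimpleGraph V} {X Y S : Finset V} (h : IsSplit G X Y) (hS : X ∪ Y = Sᶜ) :
    DisconnectsIntoNonSingletons G S := by
  have hmem : ∀ v, v ∉ S ↔ v ∈ X ∨ v ∈ Y := fun v => by
    rw [← Finset.mem_compl, ← hS, Finset.mem_union]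
  constructor
  · intro hpre
    obtain ⟨x, hx⟩ := h.nonempty_left
    obtain ⟨y, hy⟩ := h.nonempty_right
    obtain ⟨p⟩ := hpre ⟨x, (hmem x).2 (Or.inl hx)⟩ ⟨y, (hmem y).2 (Or.inr hy)⟩
    have key : ∀ (a b : {x : V | x ∉ S}), (G.induce {x : V | x ∉ S}).Walk a b →
        (a : V) ∈ X → (b : V) ∈ X := by
      intro a b p
      induction p with
      | nil => exact id
      | @cons a c b hadj _ ih =>
        intro ha
        refine ih (((hmem c).1 c.2).resolve_right fun hc => h.not_adj _ ha _ hc hadj)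
    exact Finset.disjoint_left.1 h.disjoint (key _ _ p hx) hy
  · intro c
    induction c using SimpleGraph.ConnectedComponent.ind with
    | h v =>
      obtain ⟨w, hw, hvw⟩ : ∃ w, w ∉ S ∧ G.Adj v w := by
        rcases (hmem v).1 v.2 with hv | hv
        · obtain ⟨w, hw, hvw⟩ := h.exists_adj_left _ hv
          exact ⟨w, (hmem w).2 (Or.inl hw), hvw⟩
        · obtain ⟨w, hw, hvw⟩ := h.exists_adj_right _ hv
          exact ⟨w, (hmem w).2 (Or.inr hw), hvw⟩
      have hadj : (G.induce {x : V | x ∉ S}).Adj ⟨w, hw⟩ v := hvw.symm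
      refine (Set.one_lt_ncard (Set.toFinite _)).2 ⟨v, rfl, ⟨w, hw⟩, ?_, hadj.ne'⟩
      exact SimpleGraph.ConnectedComponent.sound hadj.reachable

/-! ### Counting columns with prescribed entries, and the moments of `hits` -/

namespace IsOrthogonalArray

open Finset

variable {t n : ℕ} {A : Matrix (Fin t) (Fin (n ^ 2)) (Fin n)}

lemma bijective (hA : IsOrthogonalArray t n A) {i j : Fin t} (hij : i ≠ j) :
    Function.Bijective fun c : Fin (n ^ 2) => (A i c, A j c) := by
  refine (Fintype.bijective_iff_injective_and_card _).2 ⟨hA i j hij, ?_⟩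
  simp [sq]

lemma eq_of_eq (hA : IsOrthogonalArray t n A) {i j : Fin t} (hij : i ≠ j) {x y : Fin (n ^ 2)}
    (hi : A i x = A i y) (hj : A j x = A j y) : x = y :=
  hA i j hij (Prod.ext hi hj)

lemma card_filter_mem_and_mem (hA : IsOrthogonalArray t n A) {i j : Fin t} (hij : i ≠ j)
    (R T : Finset (Fin n)) : #{x | A i x ∈ R ∧ A j x ∈ T} = #R * #T := by
  rw [← card_product]
  refine card_bij (fun x _ => (A i x, A j x)) ?_ ?_ ?_
  · intro x hx
    simpa using hx
  · intro x _ y _ hxy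
    exact hA i j hij hxy
  · intro b hb
    obtain ⟨x, hx⟩ := (hA.bijective hij).2 b
    refine ⟨x, ?_, hx⟩
    subst hx
    simpa using hb

lemma card_filter_mem (hA : IsOrthogonalArray t n A) (ht : 2 ≤ t) (i : Fin t)
    (R : Finset (Fin n)) : #{x | A i x ∈ R} = n * #R := by
  have : Nontrivial (Fin t) := Fin.nontrivial_iff_two_le.2 ht
  obtain ⟨j, hj⟩ := exists_ne i
  have := hA.card_filter_mem_and_mem hj.symm R univ
  simpa [mul_comm] using this

end IsOrthogonalArray

/-- The number of coordinates in which the column `x` has its entry in the prescribed set. -/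
def hits {t n : ℕ} (A : Matrix (Fin t) (Fin (n ^ 2)) (Fin n)) (R : Fin t → Finset (Fin n))
    (x : Fin (n ^ 2)) : ℤ := ∑ i, if A i x ∈ R i then 1 else 0

namespace IsOrthogonalArray

open Finset

variable {t n : ℕ} {A : Matrix (Fin t) (Fin (n ^ 2)) (Fin n)}

lemma sum_hits (hA : IsOrthogonalArray t n A) (ht : 2 ≤ t) (R : Fin t → Finset (Fin n)) :
    ∑ x, hits A R x = n * ∑ i, (#(R i) : ℤ) := by
  simp only [hits]
  rw [sum_comm, mul_sum]
  refine sum_congr rfl fun i _ => ?_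
  rw [← Nat.cast_mul, ← hA.card_filter_mem ht i]
  simp

/-- Distinct coordinates behave as independent because two rows enumerate all pairs; the last
summand corrects the diagonal `i = j`. -/
lemma sum_indicator_mul (hA : IsOrthogonalArray t n A) (ht : 2 ≤ t)
    (R T : Fin t → Finset (Fin n)) (i j : Fin t) :
    ∑ x, ((if A i x ∈ R i then 1 else 0) * (if A j x ∈ T j then 1 else 0) : ℤ) =
      #(R i) * #(T j) + if i = j then (n * #(R i ∩ T i) - #(R i) * #(T i) : ℤ) else 0 := by
  have h1 : ∀ x, ((if A i x ∈ R i then 1 else 0) * (if A j x ∈ T j then 1 else 0) : ℤ) =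
      if A i x ∈ R i ∧ A j x ∈ T j then 1 else 0 := fun x => by
    split_ifs <;> simp_all
  simp only [h1]
  rw [sum_boole]
  split_ifs with hij
  · subst hij
    have := hA.card_filter_mem ht i (R i ∩ T i)
    simp only [mem_inter] at this
    rw [this]
    push_cast
    ring
  · rw [hA.card_filter_mem_and_mem hij]
    push_cast
    ring

lemma sum_hits_mul_hits (hA : IsOrthogonalArray t n A) (ht : 2 ≤ t)
    (R T : Fin t → Finset (Fin n)) :
    ∑ x, hits A R x * hits A T x = (∑ i, (#(R i) : ℤ)) * ∑ i, (#(T i) : ℤ) +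
      ∑ i, (n * #(R i ∩ T i) - #(R i) * #(T i) : ℤ) := by
  simp only [hits, sum_mul_sum]
  rw [sum_comm]
  simp_rw [sum_comm (s := univ (α := Fin (n ^ 2))), hA.sum_indicator_mul ht, sum_add_distrib]
  simp

lemma sum_hits_sub_mul (hA : IsOrthogonalArray t n A) (ht : 2 ≤ t)
    (R : Fin t → Finset (Fin n)) (a b : ℤ) :
    ∑ x, (hits A R x - a) * (hits A R x - b) = a * b * n ^ 2 +
      (1 - a - b) * n * (∑ i, (#(R i) : ℤ)) + (∑ i, (#(R i) : ℤ)) ^ 2 -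
      ∑ i, (#(R i) : ℤ) ^ 2 := by
  have h1 : ∀ x, (hits A R x - a) * (hits A R x - b) =
      hits A R x * hits A R x + (-(a + b) * hits A R x + a * b) := fun x => by ring
  simp only [h1, sum_add_distrib, ← mul_sum, hA.sum_hits ht, hA.sum_hits_mul_hits ht, inter_self,
    sum_sub_distrib]
  simp only [sum_const, card_univ, Fintype.card_fin, nsmul_eq_mul, ← sq]
  push_cast
  ring

end IsOrthogonalArray

/-! ### Strong regularity and connectedness -/

namespace IsOrthogonalArray

open Finset

variable {t n : ℕ} {A : Matrix (Fin t) (Fin (n ^ 2)) (Fin n)}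

/-- Distinct columns agree in at most one coordinate, so `hits` for the entries of a single column
is adjacency plus a diagonal term. Degrees and common neighbours are then moments of `hits`. -/
lemma hits_singleton (hA : IsOrthogonalArray t n A) (c x : Fin (n ^ 2)) :
    hits A (fun i => {A i c}) x =
      (if (orthogonalArrayGraph A).Adj c x then 1 else 0) + if x = c then (t : ℤ) else 0 := by
  by_cases hx : x = c
  · subst hx
    simp [hits]
  · simp only [hits, mem_singleton, hx, if_false, add_zero]
    split_ifs with h
    · obtain ⟨_, i, hi⟩ := h
      rw [sum_eq_single i]
      · simp [hi]
      · intro j _ hji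
        rw [if_neg]
        exact fun hj => hx (hA.eq_of_eq hji hj hi.symm)
      · simp
    · refine sum_eq_zero fun i _ => if_neg fun hi => h ⟨Ne.symm hx, i, hi.symm⟩

lemma _root_.hits_singleton_comm (A : Matrix (Fin t) (Fin (n ^ 2)) (Fin n)) (c d : Fin (n ^ 2)) :
    hits A (fun i => {A i c}) d = hits A (fun i => {A i d}) c := by
  simp only [hits, mem_singleton, eq_comm]

lemma degree_eq (hA : IsOrthogonalArray t n A) (ht : 2 ≤ t) (c : Fin (n ^ 2)) :
    ((orthogonalArrayGraph A).degree c : ℤ) = t * n - t := by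
  have h := hA.sum_hits ht (fun i => {A i c})
  simp only [hA.hits_singleton, sum_add_distrib, sum_boole, sum_ite_eq', mem_univ, if_true,
    card_singleton, Nat.cast_one, sum_const, card_univ, Fintype.card_fin, nsmul_eq_mul,
    mul_one] at h
  rw [← SimpleGraph.card_neighborFinset_eq_degree, SimpleGraph.neighborFinset_eq_filter]
  linarith

lemma card_commonNeighbors_eq (hA : IsOrthogonalArray t n A) (ht : 2 ≤ t) {c d : Fin (n ^ 2)}
    (hcd : c ≠ d) :
    (Fintype.card ((orthogonalArrayGraph A).commonNeighbors c d) : ℤ) =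
      t * (t - 1) + if (orthogonalArrayGraph A).Adj c d then (n - 2 * t : ℤ) else 0 := by
  have h := hA.sum_hits_mul_hits ht (fun i => {A i c}) (fun i => {A i d})
  have hinter : ∑ i, ((n : ℤ) * #({A i c} ∩ {A i d} : Finset (Fin n)) - 1) =
      n * hits A (fun i => {A i c}) d - t := by
    rw [sum_sub_distrib, ← mul_sum, hits]
    simp only [sum_const, card_univ, Fintype.card_fin, nsmul_eq_mul, mul_one, mem_singleton]
    congr 2
    refine sum_congr rfl fun i _ => ?_
    by_cases hi : A i d = A i c
    · simp [hi]
    · simp [hi]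
  have hprod : ∀ x, hits A (fun i => {A i c}) x * hits A (fun i => {A i d}) x =
      (if (orthogonalArrayGraph A).Adj c x ∧ (orthogonalArrayGraph A).Adj d x then 1 else 0) +
      ((if x = c then t * hits A (fun i => {A i c}) d else 0) +
        if x = d then t * hits A (fun i => {A i c}) d else 0) := by
    intro x
    by_cases hxc : x = c
    · subst hxc
      rw [← hits_singleton_comm A x d, hA.hits_singleton x x]
      simp [hcd]
    by_cases hxd : x = d
    · subst hxd
      rw [hA.hits_singleton x x]
      simp [hcd.symm, mul_comm]
    rw [hA.hits_singleton, hA.hits_singleton]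
    by_cases h1 : (orthogonalArrayGraph A).Adj c x <;>
      by_cases h2 : (orthogonalArrayGraph A).Adj d x <;> simp [hxc, hxd, h1, h2]
  simp only [card_singleton, Nat.cast_one, mul_one, hinter, hprod, sum_add_distrib, sum_boole,
    sum_ite_eq', mem_univ, if_true, sum_const, card_univ, Fintype.card_fin, nsmul_eq_mul] at h
  rw [hA.hits_singleton, if_neg hcd.symm, add_zero] at h
  have hcard : Fintype.card ((orthogonalArrayGraph A).commonNeighbors c d) =
      #{x | (orthogonalArrayGraph A).Adj c x ∧ (orthogonalArrayGraph A).Adj d x} := by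
    rw [← Set.toFinset_card]
    congr 1
    ext x
    simp [SimpleGraph.mem_commonNeighbors]
  rw [hcard]
  split_ifs at h ⊢ <;> linarith

lemma isSRGWith (hA : IsOrthogonalArray t n A) (ht : 2 ≤ t) (hn : 2 ≤ n) :
    (orthogonalArrayGraph A).IsSRGWith (n ^ 2) (t * (n - 1)) (n - 2 + (t - 1) * (t - 2))
      (t * (t - 1)) where
  card := Fintype.card_fin _
  regular c := by
    zify [show 1 ≤ n by omega]
    rw [hA.degree_eq ht]
    ring
  of_adj c d h := by
    zify [ht, hn, show 1 ≤ t by omega]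
    rw [hA.card_commonNeighbors_eq ht h.ne, if_pos h]
    ring
  of_not_adj c d hne h := by
    zify [show 1 ≤ t by omega]
    rw [hA.card_commonNeighbors_eq ht hne, if_neg h]
    ring

lemma connected (hA : IsOrthogonalArray t n A) (ht : 2 ≤ t) (hn : 1 ≤ n) :
    (orthogonalArrayGraph A).Connected := by
  have : NeZero (n ^ 2) := ⟨by positivity⟩
  refine (SimpleGraph.connected_iff _).2 ⟨fun c d => ?_, ⟨0⟩⟩
  by_cases hcd : c = d
  · rw [hcd]
  by_cases hadj : (orthogonalArrayGraph A).Adj c d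
  · exact hadj.reachable
  have h := hA.card_commonNeighbors_eq ht hcd
  rw [if_neg hadj, add_zero] at h
  have hpos : 0 < Fintype.card ((orthogonalArrayGraph A).commonNeighbors c d) := by
    zify
    rw [h]
    have : (2 : ℤ) ≤ t := by exact_mod_cast ht
    exact mul_pos (by linarith) (by linarith)
  obtain ⟨x, hx⟩ := Fintype.card_pos_iff.1 hpos
  rw [SimpleGraph.mem_commonNeighbors] at hx
  exact hx.1.reachable.trans hx.2.symm.reachable

end IsOrthogonalArray

/-! ### The counting inequality and estimates on the number of entries -/

/-- The entries that the columns of `X` have in each coordinate. -/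
def entries {t n : ℕ} (A : Matrix (Fin t) (Fin (n ^ 2)) (Fin n)) (X : Finset (Fin (n ^ 2)))
    (i : Fin t) : Finset (Fin n) := X.image (A i)

namespace IsOrthogonalArray

open Finset

variable {t n : ℕ} {A : Matrix (Fin t) (Fin (n ^ 2)) (Fin n)}

lemma _root_.hits_entries_of_mem {X : Finset (Fin (n ^ 2))} {x : Fin (n ^ 2)} (hx : x ∈ X) :
    hits A (entries A X) x = t := by
  have : ∀ i, A i x ∈ entries A X i := fun i => mem_image_of_mem _ hx
  simp [hits, this]

lemma _root_.hits_entries_eq_zero {X : Finset (Fin (n ^ 2))} {y : Fin (n ^ 2)} (hy : y ∉ X)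
    (h : ∀ x ∈ X, ¬ (orthogonalArrayGraph A).Adj x y) : hits A (entries A X) y = 0 := by
  refine sum_eq_zero fun i _ => if_neg fun hi => ?_
  obtain ⟨x, hx, hxy⟩ := mem_image.1 hi
  exact h x hx ⟨fun he => hy (he ▸ hx), i, hxy⟩

/-- No integer lies strictly between `a` and `a + 1`. -/
lemma _root_.mul_sub_one_nonneg (m a : ℤ) : 0 ≤ (m - a) * (m - (a + 1)) := by
  rcases le_or_gt m a with h | h
  · exact mul_nonneg_of_nonpos_of_nonpos (by linarith) (by linarith)
  · exact mul_nonneg (by linarith) (by linarith [Int.add_one_le_iff.2 h])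

/-- The main counting inequality for two sets of columns without edges between them. -/
lemma card_add_card_le (hA : IsOrthogonalArray t n A) (ht : 2 ≤ t) {X Y : Finset (Fin (n ^ 2))}
    (hXY : Disjoint X Y) (h : ∀ x ∈ X, ∀ y ∈ Y, ¬ (orthogonalArrayGraph A).Adj x y) (a : ℤ) :
    (t - a) * (t - (a + 1)) * #X + a * (a + 1) * #Y ≤ a * (a + 1) * n ^ 2 -
      2 * a * n * (∑ i, (#(entries A X i) : ℤ)) + (∑ i, (#(entries A X i) : ℤ)) ^ 2 -
      ∑ i, (#(entries A X i) : ℤ) ^ 2 := by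
  have hsum := hA.sum_hits_sub_mul ht (entries A X) a (a + 1)
  have hle : ∑ x ∈ X ∪ Y, (hits A (entries A X) x - a) * (hits A (entries A X) x - (a + 1)) ≤
      ∑ x, (hits A (entries A X) x - a) * (hits A (entries A X) x - (a + 1)) :=
    sum_le_sum_of_subset_of_nonneg (subset_univ _) fun x _ _ => mul_sub_one_nonneg _ _
  rw [sum_union hXY,
    sum_congr rfl (g := fun _ => ((t : ℤ) - a) * (t - (a + 1))) fun x hx => by
      rw [hits_entries_of_mem hx],
    sum_congr (s₁ := Y) rfl (g := fun _ => a * (a + 1)) fun y hy => by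
      rw [hits_entries_eq_zero (disjoint_right.1 hXY hy) fun x hx => h x hx y hy]; ring] at hle
  simp only [sum_const, nsmul_eq_mul] at hle
  linarith

lemma card_entries_add_card_entries_le {X Y : Finset (Fin (n ^ 2))} (hXY : Disjoint X Y)
    (h : ∀ x ∈ X, ∀ y ∈ Y, ¬ (orthogonalArrayGraph A).Adj x y) (i : Fin t) :
    #(entries A X i) + #(entries A Y i) ≤ n := by
  have hd : Disjoint (entries A X i) (entries A Y i) := by
    rw [disjoint_left]
    intro a ha hb
    obtain ⟨x, hx, rfl⟩ := mem_image.1 ha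
    obtain ⟨y, hy, hxy⟩ := mem_image.1 hb
    exact h x hx y hy ⟨fun he => disjoint_left.1 hXY hx (he ▸ hy), i, hxy.symm⟩
  rw [← card_union_of_disjoint hd]
  simpa using card_le_univ (entries A X i ∪ entries A Y i)

lemma sum_card_entries_add_le {X Y : Finset (Fin (n ^ 2))} (hXY : Disjoint X Y)
    (h : ∀ x ∈ X, ∀ y ∈ Y, ¬ (orthogonalArrayGraph A).Adj x y) :
    ∑ i, (#(entries A X i) : ℤ) + ∑ i, (#(entries A Y i) : ℤ) ≤ t * n := by
  rw [← sum_add_distrib]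
  calc _ ≤ ∑ _i : Fin t, (n : ℤ) := sum_le_sum fun i _ => by
        exact_mod_cast card_entries_add_card_entries_le hXY h i
    _ = _ := by simp

lemma card_entries_pair (hA : IsOrthogonalArray t n A) {u v : Fin (n ^ 2)} (huv : u ≠ v)
    {c : Fin t} (hc : A c u = A c v) (i : Fin t) :
    #(entries A {u, v} i) = if i = c then 1 else 2 := by
  rw [entries, image_insert, image_singleton]
  split_ifs with hi
  · simp [hi, hc]
  · exact card_pair fun h => huv (hA.eq_of_eq hi h hc)

lemma sum_card_entries_pair (hA : IsOrthogonalArray t n A) {u v : Fin (n ^ 2)}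
    (huv : (orthogonalArrayGraph A).Adj u v) :
    ∑ i, (#(entries A {u, v} i) : ℤ) = 2 * t - 1 := by
  obtain ⟨hne, c, hc⟩ := huv
  have : ∀ i, (#(entries A {u, v} i) : ℤ) = 2 - if i = c then 1 else 0 := fun i => by
    rw [hA.card_entries_pair hne hc]
    split_ifs <;> simp
  simp only [this, sum_sub_distrib]
  simp [mul_comm]

lemma le_sum_card_entries (hA : IsOrthogonalArray t n A) {X : Finset (Fin (n ^ 2))}
    {u v : Fin (n ^ 2)} (hu : u ∈ X) (hv : v ∈ X) (huv : (orthogonalArrayGraph A).Adj u v) :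
    2 * (t : ℤ) - 1 ≤ ∑ i, (#(entries A X i) : ℤ) := by
  rw [← hA.sum_card_entries_pair huv]
  refine sum_le_sum fun i _ => ?_
  have : entries A {u, v} i ⊆ entries A X i :=
    image_subset_image (by simp [insert_subset_iff, hu, hv])
  exact_mod_cast card_le_card this

/-- In a set without isolated vertices every column shares one of its entries. -/
lemma two_mul_sum_card_entries_le {X : Finset (Fin (n ^ 2))}
    (h : ∀ x ∈ X, ∃ y ∈ X, (orthogonalArrayGraph A).Adj x y) :
    2 * ∑ i, (#(entries A X i) : ℤ) ≤ (2 * t - 1) * #X := by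
  -- `D i` collects the columns whose `i`-th entry is repeated in `X`. They yield at most half as
  -- many entries, and the `D i` cover `X`.
  set D : Fin t → Finset (Fin (n ^ 2)) := fun i => {x ∈ X | ∃ y ∈ X, x ≠ y ∧ A i x = A i y}
  have h1 : ∀ i, 2 * (#(entries A X i) : ℤ) ≤ 2 * #X - #(D i) := by
    intro i
    have hD : 2 * #((D i).image (A i)) ≤ #(D i) := by
      refine mul_card_image_le_card _ 2 fun b hb => ?_
      obtain ⟨x, hx, rfl⟩ := mem_image.1 hb
      obtain ⟨hxX, y, hy, hne, hxy⟩ := mem_filter.1 hx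
      refine one_lt_card.2 ⟨x, mem_filter.2 ⟨hx, rfl⟩, y, mem_filter.2 ⟨?_, hxy.symm⟩, hne⟩
      exact mem_filter.2 ⟨hy, x, hxX, hne.symm, hxy.symm⟩
    have hX : entries A X i = (X \ D i).image (A i) ∪ (D i).image (A i) := by
      rw [← image_union, sdiff_union_of_subset (filter_subset _ _), entries]
    have h2 : #(entries A X i) ≤ #(X \ D i) + #((D i).image (A i)) := by
      rw [hX]
      exact (card_union_le _ _).trans (Nat.add_le_add_right card_image_le _)
    have h3 : #(X \ D i) + #(D i) = #X := card_sdiff_add_card_eq_card (filter_subset _ _)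
    omega
  have h2 : (#X : ℤ) ≤ ∑ i, (#(D i) : ℤ) := by
    have : X ⊆ univ.biUnion D := by
      intro x hx
      obtain ⟨y, hy, hne, i, hi⟩ := h x hx
      exact mem_biUnion.2 ⟨i, mem_univ _, mem_filter.2 ⟨hx, y, hy, hne, hi⟩⟩
    exact_mod_cast (card_le_card this).trans card_biUnion_le
  have h3 : ∑ i, 2 * (#(entries A X i) : ℤ) ≤ ∑ i, (2 * (#X : ℤ) - #(D i)) :=
    sum_le_sum fun i _ => h1 i
  rw [← mul_sum, sum_sub_distrib] at h3
  simp only [sum_const, card_univ, Fintype.card_fin, nsmul_eq_mul] at h3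
  linarith

lemma sq_sum_card_entries_le (X : Finset (Fin (n ^ 2))) :
    (∑ i, (#(entries A X i) : ℤ)) ^ 2 ≤ t * ∑ i, (#(entries A X i) : ℤ) ^ 2 := by
  simpa using sq_sum_le_card_mul_sum_sq (s := univ) (f := fun i => (#(entries A X i) : ℤ))

end IsOrthogonalArray

/-! ### Upper bounds for splits -/

namespace IsSplit

open Finset

lemma two_le_card_left {V : Type*} {G : SimpleGraph V} {X Y : Finset V} (h : IsSplit G X Y) :
    2 ≤ #X := by
  obtain ⟨x, hx⟩ := h.nonempty_left
  obtain ⟨y, hy, hxy⟩ := h.exists_adj_left x hx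
  exact one_lt_card.2 ⟨x, hx, y, hy, hxy.ne⟩

variable {t n : ℕ} {A : Matrix (Fin t) (Fin (n ^ 2)) (Fin n)} {X Y : Finset (Fin (n ^ 2))}

lemma le_sum_card_entries (hA : IsOrthogonalArray t n A)
    (h : IsSplit (orthogonalArrayGraph A) X Y) :
    2 * (t : ℤ) - 1 ≤ ∑ i, (#(entries A X i) : ℤ) := by
  obtain ⟨u, hu⟩ := h.nonempty_left
  obtain ⟨v, hv, huv⟩ := h.exists_adj_left u hu
  exact hA.le_sum_card_entries hu hv huv

lemma card_add_card_le_of_three {n : ℕ} {A : Matrix (Fin 3) (Fin (n ^ 2)) (Fin n)}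
    {X Y : Finset (Fin (n ^ 2))} (hA : IsOrthogonalArray 3 n A)
    (h : IsSplit (orthogonalArrayGraph A) X Y) :
    (#X : ℤ) + #Y ≤ n ^ 2 - 5 * n + 8 := by
  have h1 := hA.card_add_card_le (by norm_num) h.disjoint h.not_adj 1
  have h2 := h.le_sum_card_entries hA
  have h3 := h.symm.le_sum_card_entries hA
  have h4 := IsOrthogonalArray.sum_card_entries_add_le h.disjoint h.not_adj
  have h5 := IsOrthogonalArray.sq_sum_card_entries_le (A := A) X
  generalize (∑ i, (#(entries A X i) : ℤ)) = e at *
  generalize (∑ i, (#(entries A Y i) : ℤ)) = f at *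
  generalize (∑ i, (#(entries A X i) : ℤ) ^ 2) = p at *
  push_cast at *
  -- The bound `n² - ne + e²/3` is convex in `e` and equal at the ends `5` and `3n - 5`, with value
  -- `n² - 5n + 25/3`; integrality then gives `8`.
  have h6 : 0 ≤ (e - 5) * (3 * n - 5 - e) := mul_nonneg (by linarith) (by linarith)
  have h7 : 3 * ((#X : ℤ) + #Y) < 3 * (n ^ 2 - 5 * n + 9) := by nlinarith
  linarith [Int.lt_add_one_iff.1 (show (#X : ℤ) + #Y < n ^ 2 - 5 * n + 8 + 1 by linarith)]

/-- One edge inside `X` already suffices: apply the inequality with `a = 1` to that edge, which has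
7 entries, and `Y`. -/
lemma card_right_le_of_four {n : ℕ} {A : Matrix (Fin 4) (Fin (n ^ 2)) (Fin n)}
    {X Y : Finset (Fin (n ^ 2))} (hA : IsOrthogonalArray 4 n A)
    (h : IsSplit (orthogonalArrayGraph A) X Y) :
    (#Y : ℤ) ≤ n ^ 2 - 7 * n + 12 := by
  obtain ⟨u, hu⟩ := h.nonempty_left
  obtain ⟨v, hv, huv⟩ := h.exists_adj_left u hu
  have hsub : {u, v} ⊆ X := by simp [insert_subset_iff, hu, hv]
  have h1 := hA.card_add_card_le (by norm_num) (h.disjoint.mono_left hsub)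
    (fun x hx => h.not_adj x (hsub hx)) 1
  have h5 := IsOrthogonalArray.sq_sum_card_entries_le (A := A) {u, v}
  rw [hA.sum_card_entries_pair huv, card_pair huv.ne] at h1
  rw [hA.sum_card_entries_pair huv] at h5
  generalize (∑ i, (#(entries A {u, v} i) : ℤ) ^ 2) = p at *
  push_cast at *
  generalize hN : (n : ℤ) ^ 2 = N at *
  omega

lemma card_add_card_le_of_four_of_sum_le {n : ℕ} {A : Matrix (Fin 4) (Fin (n ^ 2)) (Fin n)}
    {X Y : Finset (Fin (n ^ 2))} (hA : IsOrthogonalArray 4 n A) (hn : 6 ≤ n)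
    (h : IsSplit (orthogonalArrayGraph A) X Y)
    (hle : ∑ i, (#(entries A X i) : ℤ) ≤ 2 * n) :
    (#X : ℤ) + #Y ≤ n ^ 2 - 7 * n + 14 := by
  have h1 := hA.card_add_card_le (by norm_num) h.disjoint h.not_adj 1
  have h1' := hA.card_add_card_le (by norm_num) h.disjoint h.not_adj 2
  have h2 := h.le_sum_card_entries hA
  have h3 := IsOrthogonalArray.two_mul_sum_card_entries_le h.exists_adj_left
  have h5 := IsOrthogonalArray.sq_sum_card_entries_le (A := A) X
  have h6 := h.two_le_card_left
  generalize (∑ i, (#(entries A X i) : ℤ)) = e at *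
  generalize (∑ i, (#(entries A X i) : ℤ) ^ 2) = p at *
  push_cast at *
  zify at h6 hn
  generalize (#X : ℤ) = P at *
  generalize (#Y : ℤ) = Q at *
  generalize (n : ℤ) = n at *
  by_contra! hcon
  rcases lt_or_ge e 12 with he | he
  -- For `7 ≤ e ≤ 11` the case `a = 1` suffices: it weights `#X` by 6 and `#Y` by 2, and the absence
  -- of isolated vertices bounds `#X` below by `2e/7`.
  · interval_cases e <;> norm_num at * <;> generalize n ^ 2 = N at * <;> omega
  -- Adding the cases `a = 1, 2` gives `n² - 3ne/4 + 3e²/16`, decreasing for `e ≤ 2n`. At `e = 12`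
  -- it is at most the target once `n ≥ 7`; for `n = 6` it exceeds it by one, and rounding the two
  -- inequalities separately removes the excess.
  · rcases eq_or_lt_of_le hn with rfl | hn
    · obtain rfl : e = 12 := by omega
      norm_num at *
      omega
    · nlinarith [mul_nonneg (show 0 ≤ e - 11 by linarith) (show 0 ≤ 2 * n - e by linarith),
        mul_nonneg (show 0 ≤ e - 11 by linarith) (show 0 ≤ n - 7 by linarith)]

lemma card_add_card_le_of_four {n : ℕ} {A : Matrix (Fin 4) (Fin (n ^ 2)) (Fin n)}
    {X Y : Finset (Fin (n ^ 2))} (hA : IsOrthogonalArray 4 n A) (hn : 5 ≤ n)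
    (h : IsSplit (orthogonalArrayGraph A) X Y) :
    (#X : ℤ) + #Y ≤ n ^ 2 - 7 * n + 14 := by
  rcases eq_or_lt_of_le hn with rfl | hn
  · have h1 := h.card_right_le_of_four hA
    have h2 := h.symm.card_right_le_of_four hA
    norm_num at *
    linarith
  · have h4 := IsOrthogonalArray.sum_card_entries_add_le h.disjoint h.not_adj
    push_cast at h4
    rcases le_total (∑ i, (#(entries A X i) : ℤ)) (2 * n) with hle | hle
    · exact h.card_add_card_le_of_four_of_sum_le hA hn hle
    · have := h.symm.card_add_card_le_of_four_of_sum_le hA hn (by linarith)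
      linarith

end IsSplit

/-! ### Far columns of an edge -/

open Finset in
/-- The columns that share no entry with `u` or `v`. -/
def farColumns {t n : ℕ} (A : Matrix (Fin t) (Fin (n ^ 2)) (Fin n)) (u v : Fin (n ^ 2)) :
    Finset (Fin (n ^ 2)) := {x | ∀ i, A i x ∉ entries A {u, v} i}

namespace IsOrthogonalArray

open Finset

variable {t n : ℕ} {A : Matrix (Fin t) (Fin (n ^ 2)) (Fin n)}

lemma _root_.mem_farColumns {u v x : Fin (n ^ 2)} :
    x ∈ farColumns A u v ↔ ∀ i, A i u ≠ A i x ∧ A i v ≠ A i x := by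
  simp [farColumns, entries, eq_comm]

lemma not_adj_of_mem_farColumns {u v x y : Fin (n ^ 2)} (hx : x ∈ ({u, v} : Finset _))
    (hy : y ∈ farColumns A u v) : ¬ (orthogonalArrayGraph A).Adj x y := by
  rintro ⟨_, i, hi⟩
  rw [mem_farColumns] at hy
  simp only [mem_insert, mem_singleton] at hx
  rcases hx with rfl | rfl
  · exact (hy i).1 hi
  · exact (hy i).2 hi

lemma disjoint_pair_farColumns (ht : 1 ≤ t) (u v : Fin (n ^ 2)) :
    Disjoint {u, v} (farColumns A u v) := by
  rw [disjoint_left]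
  intro x hx hy
  rw [mem_farColumns] at hy
  simp only [mem_insert, mem_singleton] at hx
  rcases hx with rfl | rfl
  · exact (hy ⟨0, ht⟩).1 rfl
  · exact (hy ⟨0, ht⟩).2 rfl

lemma card_farColumns (hA : IsOrthogonalArray t n A) (ht : 2 ≤ t) {u v : Fin (n ^ 2)}
    (huv : (orthogonalArrayGraph A).Adj u v) :
    (#(farColumns A u v) : ℤ) = n ^ 2 - (2 * t - 1) * n + t * (t - 1) := by
  set G := orthogonalArrayGraph A
  have hcompl : (farColumns A u v)ᶜ = G.neighborFinset u ∪ G.neighborFinset v := by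
    ext x
    simp only [mem_compl, mem_farColumns, mem_union, SimpleGraph.mem_neighborFinset]
    constructor
    · intro h
      push Not at h
      obtain ⟨i, hi⟩ := h
      by_cases hu : u = x
      · exact Or.inr (hu ▸ huv.symm)
      by_cases hv : v = x
      · exact Or.inl (hv ▸ huv)
      by_cases hui : A i u = A i x
      · exact Or.inl ⟨hu, i, hui⟩
      · exact Or.inr ⟨hv, i, hi hui⟩
    · rintro (⟨_, i, hi⟩ | ⟨_, i, hi⟩) h
      · exact (h i).1 hi
      · exact (h i).2 hi
  have h1 := card_union_add_card_inter (G.neighborFinset u) (G.neighborFinset v)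
  have h2 : #(G.neighborFinset u ∩ G.neighborFinset v) = Fintype.card (G.commonNeighbors u v) := by
    rw [← Set.toFinset_card]
    congr 1
    ext x
    simp [SimpleGraph.mem_commonNeighbors]
  have h3 := card_add_card_compl (farColumns A u v)
  have h4 := hA.card_commonNeighbors_eq ht huv.ne
  rw [if_pos huv] at h4
  rw [← hcompl, h2, SimpleGraph.card_neighborFinset_eq_degree,
    SimpleGraph.card_neighborFinset_eq_degree] at h1
  rw [Fintype.card_fin] at h3
  have h5 := hA.degree_eq ht u
  have h6 := hA.degree_eq ht v
  zify at h1 h3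
  linarith

/-- In a coordinate `i` where `u` and `v` differ, `n` columns share the entry of `w`. The other
coordinates exclude at most `(2t - 1) - 2 = 2t - 3` of them, so at least two far columns remain. -/
lemma exists_adj_of_two_mul_sub_one_le (hA : IsOrthogonalArray t n A) (ht : 2 ≤ t)
    (hn : 2 * t - 1 ≤ n) {u v : Fin (n ^ 2)} (huv : (orthogonalArrayGraph A).Adj u v)
    {w : Fin (n ^ 2)} (hw : w ∈ farColumns A u v) :
    ∃ x ∈ farColumns A u v, (orthogonalArrayGraph A).Adj w x := by
  obtain ⟨hne, c, hc⟩ := id huv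
  have : Nontrivial (Fin t) := Fin.nontrivial_iff_two_le.2 ht
  obtain ⟨i, hi⟩ := exists_ne c
  set L : Finset (Fin (n ^ 2)) := {x | A i x ∈ ({A i w} : Finset (Fin n))} with hL
  set M : Finset (Fin (n ^ 2)) := (univ.erase i).biUnion fun j =>
    {x | A i x ∈ ({A i w} : Finset (Fin n)) ∧ A j x ∈ entries A {u, v} j} with hM
  have hcL : #L = n := by rw [hL, hA.card_filter_mem ht]; simp
  have hcM : #M ≤ ∑ j ∈ univ.erase i, #(entries A {u, v} j) := by
    refine card_biUnion_le.trans (sum_le_sum fun j hj => ?_)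
    rw [hA.card_filter_mem_and_mem (ne_of_mem_erase hj).symm]
    simp
  have hsum := hA.sum_card_entries_pair huv
  rw [← add_sum_erase _ _ (mem_univ i), hA.card_entries_pair hne hc, if_neg hi,
    ← Nat.cast_sum] at hsum
  have hwL : w ∈ L := by simp [hL]
  have hwM : w ∉ M := by
    simp only [hM, mem_biUnion, mem_filter, not_exists, not_and]
    intro j _ _ _
    exact (mem_filter.1 hw).2 j
  have hcard : 1 < #(L \ M) := by
    have := le_card_sdiff M L
    rw [Nat.cast_ofNat] at hsum
    omega
  obtain ⟨x, hx, hxw⟩ := exists_mem_ne hcard w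
  rw [mem_sdiff] at hx
  have hxi : A i x = A i w := by simpa [hL] using hx.1
  refine ⟨x, mem_filter.2 ⟨mem_univ _, fun j hj => ?_⟩, hxw.symm, i, hxi.symm⟩
  by_cases hji : j = i
  · subst hji
    rw [hxi] at hj
    exact (mem_filter.1 hw).2 j hj
  · refine hx.2 (mem_biUnion.2 ⟨j, mem_erase.2 ⟨hji, mem_univ _⟩, ?_⟩)
    simp [hxi, hj]

end IsOrthogonalArray

/-! ### The parity argument for order six -/

namespace IsOrthogonalArray

open Finset

/-- The sum of `hits` over the columns with entry `a` in coordinate `c` is congruent mod `n` to the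
sum of the `#(R i)` with `i ≠ c`, hence odd. -/
lemma exists_odd_hits {t n : ℕ} {A : Matrix (Fin t) (Fin (n ^ 2)) (Fin n)}
    (hA : IsOrthogonalArray t n A) (ht : 2 ≤ t) (hn : Even n) (R : Fin t → Finset (Fin n))
    (c : Fin t) (hR : Odd (∑ i, (#(R i) : ℤ) - #(R c))) (a : Fin n) :
    ∃ x, A c x = a ∧ Odd (hits A R x) := by
  have h := hA.sum_hits_mul_hits ht (fun i => if i = c then {a} else ∅) R
  have hhit : ∀ x, hits A (fun i => if i = c then {a} else ∅) x = if A c x = a then 1 else 0 := by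
    intro x
    rw [hits, sum_eq_single c]
    · simp
    · intro i _ hi
      simp [hi]
    · simp
  have hsum : ∑ i, ((n : ℤ) * #((if i = c then {a} else ∅) ∩ R i) -
      #(if i = c then ({a} : Finset (Fin n)) else ∅) * #(R i)) =
      n * #({a} ∩ R c) - #(R c) := by
    rw [sum_eq_single c]
    · simp
    · intro i _ hi
      simp [hi]
    · simp
  have hcard : ∑ i, (#(if i = c then ({a} : Finset (Fin n)) else ∅) : ℤ) = 1 := by
    rw [sum_eq_single c]
    · simp
    · intro i _ hi
      simp [hi]
    · simp
  rw [hsum, hcard] at h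
  by_contra! hcon
  have heven : Even (∑ x, hits A (fun i => if i = c then {a} else ∅) x * hits A R x) := by
    refine even_sum _ fun x _ => ?_
    rw [hhit]
    split_ifs with hx
    · rw [one_mul, ← Int.not_odd_iff_even]
      exact hcon x hx
    · simp
  rw [h] at heven
  have hev : Even ((n : ℤ) * #({a} ∩ R c)) := ((Int.even_coe_nat n).2 hn).mul_right _
  have : Odd (1 * ∑ i, (#(R i) : ℤ) + (n * #({a} ∩ R c) - #(R c))) := by
    have := hR.add_even hev
    convert this using 1
    ring
  exact Int.not_even_iff_odd.2 this heven

/-- Two collinear columns of a four-rowed array of order six have no isolated far column. -/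
lemma exists_adj_of_six {A : Matrix (Fin 4) (Fin (6 ^ 2)) (Fin 6)}
    (hA : IsOrthogonalArray 4 6 A) {u v : Fin (6 ^ 2)} (huv : (orthogonalArrayGraph A).Adj u v)
    {w : Fin (6 ^ 2)} (hw : w ∈ farColumns A u v) :
    ∃ x ∈ farColumns A u v, (orthogonalArrayGraph A).Adj w x := by
  by_contra! hiso
  obtain ⟨hne, c, hc⟩ := id huv
  have hcardR : ∀ i, #(entries A {u, v, w} i) = if i = c then 2 else 3 := by
    intro i
    have h1 : entries A {u, v, w} i = insert (A i w) (entries A {u, v} i) := by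
      simp only [entries, image_insert, image_singleton]
      ext; simp; tauto
    rw [h1, card_insert_of_notMem ((mem_filter.1 hw).2 i), hA.card_entries_pair hne hc]
    split_ifs <;> rfl
  set m := hits A (entries A {u, v, w}) with hm
  -- The contradiction: an isolated `w` puts `m` in `{0, 4}` on all 8 columns of `T`, contributing
  -- 32, while each of the 6 entries in coordinate `c` supplies a column with odd `m`, contributing
  -- at least 1. But `32 + 6 > 36`.
  have hsum : ∑ x, (m x - 2) * (m x - 2) = 36 := by
    rw [hA.sum_hits_sub_mul (by norm_num)]
    simp only [hcardR]
    fin_cases c <;> simp [Fin.sum_univ_four]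
  set T := {u, v} ∪ farColumns A u v with hT
  set D : Finset (Fin (6 ^ 2)) := {x | Odd (m x)} with hD
  have hcT : #T = 8 := by
    have h := hA.card_farColumns (by norm_num) huv
    rw [hT, card_union_of_disjoint (disjoint_pair_farColumns (by norm_num) u v), card_pair hne]
    norm_num at h
    omega
  have hTm : ∀ x ∈ T, m x = 0 ∨ m x = 4 := by
    intro x hx
    by_cases hx' : x ∈ ({u, v, w} : Finset _)
    · right
      exact hits_entries_of_mem hx'
    · left
      have hxW : x ∈ farColumns A u v := by
        simp only [hT, mem_union, mem_insert, mem_singleton] at hx hx'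
        tauto
      refine hits_entries_eq_zero hx' fun y hy => ?_
      simp only [mem_insert, mem_singleton] at hy
      rcases hy with rfl | rfl | rfl
      · exact not_adj_of_mem_farColumns (by simp) hxW
      · exact not_adj_of_mem_farColumns (by simp) hxW
      · exact hiso x hxW
  have hcD : 6 ≤ #D := by
    have himage : D.image (A c) = univ := by
      refine eq_univ_of_forall fun a => ?_
      obtain ⟨x, hx, hodd⟩ := hA.exists_odd_hits (by norm_num) (by decide)
        (entries A {u, v, w}) c (by
          simp only [hcardR]
          fin_cases c <;> simp [Fin.sum_univ_four] <;> decide) a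
      exact mem_image.2 ⟨x, mem_filter.2 ⟨mem_univ _, hodd⟩, hx⟩
    calc 6 = #(D.image (A c)) := by rw [himage]; simp
      _ ≤ #D := card_image_le
  have hTD : Disjoint T D := by
    rw [disjoint_left]
    intro x hx hxD
    have hodd := (mem_filter.1 hxD).2
    rcases hTm x hx with h | h <;> rw [h] at hodd <;> revert hodd <;> decide
  have hle : ∑ x ∈ T ∪ D, (m x - 2) * (m x - 2) ≤ ∑ x, (m x - 2) * (m x - 2) :=
    sum_le_sum_of_subset_of_nonneg (subset_univ _) fun x _ _ => mul_self_nonneg _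
  rw [sum_union hTD] at hle
  have h1 : ∑ _x ∈ T, (4 : ℤ) ≤ ∑ x ∈ T, (m x - 2) * (m x - 2) :=
    sum_le_sum fun x hx => by rcases hTm x hx with h | h <;> rw [h] <;> norm_num
  have h2 : ∑ _x ∈ D, (1 : ℤ) ≤ ∑ x ∈ D, (m x - 2) * (m x - 2) := by
    refine sum_le_sum fun x hx => ?_
    have hodd := (mem_filter.1 hx).2
    have : m x - 2 ≠ 0 := by
      intro h
      rw [show m x = 2 by linarith] at hodd
      revert hodd
      decide
    exact Int.add_one_le_iff.2 (mul_self_pos.2 this)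
  simp only [sum_const, nsmul_eq_mul, hcT] at h1 h2
  have : (6 : ℤ) ≤ #D := by exact_mod_cast hcD
  norm_num at h1 h2
  linarith

/-- The neighbourhood of an edge disconnects the graph as soon as no far column is isolated. -/
lemma exists_disconnects {t n : ℕ} {A : Matrix (Fin t) (Fin (n ^ 2)) (Fin n)}
    (hA : IsOrthogonalArray t n A) (ht : 2 ≤ t) {u v : Fin (n ^ 2)}
    (huv : (orthogonalArrayGraph A).Adj u v)
    (hpos : 0 < (n : ℤ) ^ 2 - (2 * t - 1) * n + t * (t - 1))
    (h : ∀ w ∈ farColumns A u v, ∃ x ∈ farColumns A u v, (orthogonalArrayGraph A).Adj w x) :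
    ∃ S : Finset (Fin (n ^ 2)), DisconnectsIntoNonSingletons (orthogonalArrayGraph A) S ∧
      (#S : ℤ) = (2 * t - 1) * n - t * (t - 1) - 2 := by
  have hcard := hA.card_farColumns ht huv
  have hdisj := disjoint_pair_farColumns (A := A) (by omega) u v
  have hsplit : IsSplit (orthogonalArrayGraph A) {u, v} (farColumns A u v) := by
    refine ⟨hdisj, by simp, card_pos.1 (by zify; rw [hcard]; exact hpos),
      fun x hx y hy => not_adj_of_mem_farColumns hx hy, ?_, h⟩
    intro x hx
    simp only [mem_insert, mem_singleton] at hx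
    rcases hx with rfl | rfl
    · exact ⟨v, by simp, huv⟩
    · exact ⟨u, by simp, huv.symm⟩
  refine ⟨({u, v} ∪ farColumns A u v)ᶜ,
    hsplit.disconnectsIntoNonSingletons (compl_compl _).symm, ?_⟩
  have h1 := card_add_card_compl ({u, v} ∪ farColumns A u v)
  rw [card_union_of_disjoint hdisj, card_pair huv.ne, Fintype.card_fin] at h1
  zify at h1
  linarith

end IsOrthogonalArray

/-! ### Assembling the conjecture -/

open Finset in
lemma IsSplit.card_add_card_add_card {n : ℕ} {G : SimpleGraph (Fin (n ^ 2))}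
    {X Y S : Finset (Fin (n ^ 2))} (h : IsSplit G X Y) (hS : X ∪ Y = Sᶜ) :
    (#X : ℤ) + #Y + #S = n ^ 2 := by
  have h1 := card_add_card_compl S
  rw [← hS, card_union_of_disjoint h.disjoint, Fintype.card_fin] at h1
  zify at h1
  linarith

/-- The conjecture follows once the size of the neighbourhood of an edge is shown to be a lower
bound for disconnecting sets that is attained whenever a disconnecting set exists. -/
lemma IsOrthogonalArray.satisfiesBrouwerConjecture {t n : ℕ}
    {A : Matrix (Fin t) (Fin (n ^ 2)) (Fin n)} (hA : IsOrthogonalArray t n A) (ht : 2 ≤ t)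
    (hn : 2 ≤ n)
    (hle : ∀ S X Y : Finset (Fin (n ^ 2)), IsSplit (orthogonalArrayGraph A) X Y → X ∪ Y = Sᶜ →
      (2 * (t : ℤ) - 1) * n - t * (t - 1) - 2 ≤ S.card)
    (hex : ∀ S X Y : Finset (Fin (n ^ 2)), IsSplit (orthogonalArrayGraph A) X Y → X ∪ Y = Sᶜ →
      ∃ S : Finset (Fin (n ^ 2)), DisconnectsIntoNonSingletons (orthogonalArrayGraph A) S ∧
        (S.card : ℤ) = (2 * t - 1) * n - t * (t - 1) - 2) :
    SatisfiesBrouwerConjecture (orthogonalArrayGraph A)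
      (n ^ 2) (t * (n - 1)) (n - 2 + (t - 1) * (t - 2)) (t * (t - 1)) := by
  refine ⟨hA.isSRGWith ht hn, hA.connected ht (by omega), or_iff_not_imp_left.2 fun hS => ?_⟩
  rw [not_not] at hS
  obtain ⟨S, hS⟩ := hS
  obtain ⟨X, Y, hsplit, hXY⟩ := hS.exists_isSplit
  have heq : 2 * ((t * (n - 1) : ℕ) : ℤ) - ((n - 2 + (t - 1) * (t - 2) : ℕ) : ℤ) - 2 =
      (2 * t - 1) * n - t * (t - 1) - 2 := by
    push_cast [ht, hn, show 1 ≤ n by omega, show 1 ≤ t by omega]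
    ring
  rw [heq]
  refine ⟨hex S X Y hsplit hXY, ?_⟩
  rintro s ⟨S', hS', rfl⟩
  obtain ⟨X', Y', hsplit', hXY'⟩ := hS'.exists_isSplit
  exact hle S' X' Y' hsplit' hXY'

theorem mainTheorem5 (t n : ℕ) (ht : t = 3 ∨ t = 4) (hn : t ≤ n)
    (A : Matrix (Fin t) (Fin (n ^ 2)) (Fin n)) (hA : IsOrthogonalArray t n A) :
    SatisfiesBrouwerConjecture (orthogonalArrayGraph A)
      (n ^ 2) (t * (n - 1)) (n - 2 + (t - 1) * (t - 2)) (t * (t - 1)) := by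
  refine hA.satisfiesBrouwerConjecture (by omega) (by omega) ?_ ?_
  · intro S X Y h hS
    have hcard := h.card_add_card_add_card hS
    rcases ht with rfl | rfl
    · have := h.card_add_card_le_of_three hA
      push_cast
      linarith
    · rcases eq_or_lt_of_le hn with rfl | hn
      · have h1 := h.card_right_le_of_four hA
        have h2 := h.symm.two_le_card_left
        push_cast at h1
        omega
      · have := h.card_add_card_le_of_four hA hn
        push_cast
        linarith
  · intro S X Y h hS
    have hcard := h.card_add_card_add_card hS
    have hX := h.two_le_card_left
    have hY := h.symm.two_le_card_left
    obtain ⟨u, hu⟩ := h.nonempty_left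
    obtain ⟨v, -, huv⟩ := h.exists_adj_left u hu
    rcases ht with rfl | rfl
    · have hle := h.card_add_card_le_of_three hA
      -- A split has at least 4 columns. The bound is 2 for `n = 3`, so there is none, and 4 for `n
      -- = 4`, so the given `S` already has the required size.
      obtain rfl | rfl | hn : n = 3 ∨ n = 4 ∨ 5 ≤ n := by omega
      · norm_num at hle
        omega
      · refine ⟨S, h.disconnectsIntoNonSingletons hS, ?_⟩
        norm_num at *
        omega
      · refine hA.exists_disconnects (by norm_num) huv ?_ fun w hw =>
          hA.exists_adj_of_two_mul_sub_one_le (by norm_num) (by omega) huv hw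
        zify at hn
        push_cast
        nlinarith
    · obtain rfl | hn : n = 4 ∨ 5 ≤ n := by omega
      · have h1 := h.card_right_le_of_four hA
        push_cast at h1
        omega
      have hle := h.card_add_card_le_of_four hA hn
      -- For `n = 5` the bound is again 4, and the given `S` is extremal.
      obtain rfl | hn : n = 5 ∨ 6 ≤ n := by omega
      · refine ⟨S, h.disconnectsIntoNonSingletons hS, ?_⟩
        norm_num at *
        omega
      · refine hA.exists_disconnects (by norm_num) huv ?_ fun w hw => ?_
        · zify at hn
          push_cast
          nlinarith
        · obtain rfl | hn : n = 6 ∨ 7 ≤ n := by omega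
          · exact hA.exists_adj_of_six huv hw
          · exact hA.exists_adj_of_two_mul_sub_one_le (by norm_num) (by omega) huv hw
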